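/- Let $k$ be a field; all categories and functors are $k$-linear. Let $\mathcal C$ be a rigid abelian monoidal category (every object has a left and a right dual, and $\otimes$ is $k$-bilinear), let $\mathcal M$ be an abelian left $\mathcal C$-module category with $k$-bilinear action $\triangleright\colon\mathcal C\times\mathcal M\to\mathcal M$, and let $X\in\mathcal M$. (1) (Theorem 5.11) Assume that $\mathcal C$ and $\mathcal M$ have enough projectives, that $X$ is closed, i.e. the functor $-\triangleright X\colon\mathcal C\to\mathcal M$ has a right adjoint $[X,-]$, and that $X$ is a $\mathcal C$-projective $\mathcal C$-generator, i.e. $P\triangleright X$ is projective for every projective $P\in\mathcal C$, and every projective object of $\mathcal M$ is a direct summand of $P\triangleright X$ for some projective $P\in\mathcal C$. Let $A=[X,X]$ be the algebra object of $\mathcal C$ whose unit $\mathbb 1\to A$ and multiplication $A\otimes A\to A$ correspond under the adjunction to the unit isomorphism $\mathbb 1\triangleright X\cong X$ and to the iterated evaluation $(A\otimes A)\triangleright X\cong A\triangleright(A\triangleright X)\to A\triangleright X\to X$. Then there is a $k$-linear equivalence of $\mathcal C$-module categories $\operatorname{mod}_{\mathcal C}(A)\simeq\mathcal M$, where $\operatorname{mod}_{\mathcal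 C}(A)$ is the category of right $A$-modules in $\mathcal C$, on which $V\in\mathcal C$ acts by $V\otimes-$. (2) (Theorem 5.12) Dually, assume that $\mathcal C$ and $\mathcal M$ have enough injectives, that $X$ is coclosed, i.e. $-\triangleright X$ has a left adjoint $[X,-]$, and that $X$ is a $\mathcal C$-injective $\mathcal C$-cogenerator, i.e. $I\triangleright X$ is injective for every injective $I\in\mathcal C$, and every injective object of $\mathcal M$ is a direct summand of $I\triangleright X$ for some injective $I\in\mathcal C$. Let $K=[X,X]$ be the coalgebra object of $\mathcal C$ whose counit and comultiplication correspond under the adjunction to $X\cong\mathbb 1\triangleright X$ and to the iterated coevaluation $X\to K\triangleright X\to K\triangleright(K\triangleright X)\cong(K\otimes K)\triangleright X$. Then there is a $k$-linear equivalence of $\mathcal C$-module categories $\operatorname{comod}_{\mathcal C}(K)\simeq\mathcal M$, where $\operatorname{comod}_{\mathcal C}(K)$ is the category of right $K$-comodules in $\mathcal C$, on which $V\in\mathcal C$ acts by $V\otimes-$. -/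

import Mathlib

open CategoryTheory MonoidalCategory Limits MonoidalLeftAction

universe w v₁ v₂ v₃ u₁ u₂ u₃

namespace ModuleCategory

noncomputable section

/-! ### Linear module categories

A (left) module category over a monoidal category `C` is a category `M` with
`MonoidalLeftAction C M`; the action of `V : C` on `Y : M` is `V ⊙ₗ Y`. -/

/-- The action functor `C × M ⥤ M` is `k`-linear in both variables. -/
class BilinearAction (k : Type w) [Field k]
    (C : Type u₁) [Category.{v₁} C] [Preadditive C] [Linear k C] [MonoidalCategory C]
    (M : Type u₂) [Category.{v₂} M] [Preadditive M] [Linear k M]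
    [MonoidalLeftAction C M] : Prop where
  add_actionHomLeft {V W : C} (f g : V ⟶ W) (Y : M) : (f + g) ⊵ₗ Y = f ⊵ₗ Y + g ⊵ₗ Y
  smul_actionHomLeft {V W : C} (a : k) (f : V ⟶ W) (Y : M) : (a • f) ⊵ₗ Y = a • (f ⊵ₗ Y)
  actionHomRight_add (V : C) {Y Z : M} (f g : Y ⟶ Z) : V ⊴ₗ (f + g) = V ⊴ₗ f + V ⊴ₗ g
  actionHomRight_smul (V : C) {Y Z : M} (a : k) (f : Y ⟶ Z) : V ⊴ₗ (a • f) = a • (V ⊴ₗ f)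

/-- `M` and `N` are equivalent as `k`-linear `C`-module categories: there is a strong `C`-module
functor `M ⥤ N` which is `k`-linear and an equivalence of categories. -/
def ModuleEquivalent (k : Type w) [Field k]
    (C : Type u₁) [Category.{v₁} C] [MonoidalCategory C]
    (M : Type u₂) [Category.{v₂} M] [Preadditive M] [Linear k M] [MonoidalLeftAction C M]
    (N : Type u₃) [Category.{v₃} N] [Preadditive N] [Linear k N] [MonoidalLeftAction C N] :
    Prop :=
  ∃ E : M ≌ N, E.functor.Additive ∧ E.functor.Linear k ∧ Nonempty (E.functor.LeftLinear C)

section Objects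

variable (C : Type u₁) [Category.{v₁} C] [MonoidalCategory C]
  {M : Type u₂} [Category.{v₂} M] [MonoidalLeftAction C M]

/-- `X` is closed: the functor `V ↦ V ⊙ₗ X` has a right adjoint. -/
abbrev IsClosedObject (X : M) : Prop := (actionRight C X).IsLeftAdjoint

/-- `X` is coclosed: the functor `V ↦ V ⊙ₗ X` has a left adjoint. -/
abbrev IsCoclosedObject (X : M) : Prop := (actionRight C X).IsRightAdjoint

/-- `X` is `C`-projective. -/
def IsCProjective (X : M) : Prop := ∀ P : C, Projective P → Projective (P ⊙ₗ X)

/-- `X` is `C`-injective. -/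
def IsCInjective (X : M) : Prop := ∀ I : C, Injective I → Injective (I ⊙ₗ X)

variable [HasZeroMorphisms M] [HasBinaryBiproducts M]

/-- `X` is a `C`-projective `C`-generator: it is `C`-projective and every projective object of `M`
is a direct summand of some `P ⊙ₗ X` with `P` projective. -/
def IsCProjectiveCGenerator (X : M) : Prop :=
  IsCProjective C X ∧ ∀ Q : M, Projective Q →
    ∃ P : C, Projective P ∧ ∃ Q' : M, Nonempty (P ⊙ₗ X ≅ Q ⊞ Q')

/-- `X` is a `C`-injective `C`-cogenerator: it is `C`-injective and every injective object of `M`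
is a direct summand of some `I ⊙ₗ X` with `I` injective. -/
def IsCInjectiveCCogenerator (X : M) : Prop :=
  IsCInjective C X ∧ ∀ J : M, Injective J →
    ∃ I : C, Injective I ∧ ∃ J' : M, Nonempty (I ⊙ₗ X ≅ J ⊞ J')

end Objects

/-! ### The algebra `[X, X]` of a closed object -/

section InternalHom

variable (C : Type u₁) [Category.{v₁} C] [MonoidalCategory C]
  {M : Type u₂} [Category.{v₂} M] [MonoidalLeftAction C M]

section Closed

variable (X : M) [IsClosedObject C X]

/-- The internal hom `[X, -]`, right adjoint to `V ↦ V ⊙ₗ X`. -/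
def internalHom : M ⥤ C := (actionRight C X).rightAdjoint

/-- The adjunction defining the internal hom. -/
def internalHomAdj : actionRight C X ⊣ internalHom C X :=
  Adjunction.ofIsLeftAdjoint (actionRight C X)

/-- The evaluation `[X, Y] ⊙ₗ X ⟶ Y`. -/
def ev (Y : M) : (internalHom C X).obj Y ⊙ₗ X ⟶ Y := (internalHomAdj C X).counit.app Y

/-- The morphism `V ⟶ [X, Y]` corresponding to `V ⊙ₗ X ⟶ Y`. -/
def curry {V : C} {Y : M} (f : V ⊙ₗ X ⟶ Y) : V ⟶ (internalHom C X).obj Y :=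
  (internalHomAdj C X).homEquiv V Y f

@[simp]
lemma curry_ev {V : C} {Y : M} (f : V ⊙ₗ X ⟶ Y) : curry C X f ⊵ₗ X ≫ ev C X Y = f := by
  exact ((internalHomAdj C X).homEquiv_counit (g := curry C X f)).symm.trans
    (((internalHomAdj C X).homEquiv V Y).symm_apply_apply f)

variable {C X} in
lemma internalHom_ext {V : C} {Y : M} {f g : V ⟶ (internalHom C X).obj Y}
    (h : f ⊵ₗ X ≫ ev C X Y = g ⊵ₗ X ≫ ev C X Y) : f = g := by
  apply ((internalHomAdj C X).homEquiv V Y).symm.injective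
  rw [Adjunction.homEquiv_counit, Adjunction.homEquiv_counit]
  exact h

/-- The object `[X, X]`. -/
def internalEnd : C := (internalHom C X).obj X

/-- The unit of `[X, X]`, corresponding to `𝟙 ⊙ₗ X ≅ X`. -/
def endOne : 𝟙_ C ⟶ internalEnd C X := curry C X (λₗ X).hom

/-- The multiplication of `[X, X]`, corresponding to the iterated evaluation
`([X, X] ⊗ [X, X]) ⊙ₗ X ≅ [X, X] ⊙ₗ [X, X] ⊙ₗ X ⟶ [X, X] ⊙ₗ X ⟶ X`. -/
def endMul : internalEnd C X ⊗ internalEnd C X ⟶ internalEnd C X :=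
  curry C X ((αₗ (internalEnd C X) (internalEnd C X) X).hom ≫
    internalEnd C X ⊴ₗ ev C X X ≫ ev C X X)

/-- The evaluation `[X, X] ⊙ₗ X ⟶ X`. -/
def evEnd : internalEnd C X ⊙ₗ X ⟶ X := ev C X X

lemma endOne_ev : endOne C X ⊵ₗ X ≫ evEnd C X = (λₗ X).hom := curry_ev C X _

lemma endMul_ev : endMul C X ⊵ₗ X ≫ evEnd C X =
    (αₗ (internalEnd C X) (internalEnd C X) X).hom ≫
      internalEnd C X ⊴ₗ evEnd C X ≫ evEnd C X := curry_ev C X _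

variable {C X} in
lemma internalEnd_ext {V : C} {f g : V ⟶ internalEnd C X}
    (h : f ⊵ₗ X ≫ evEnd C X = g ⊵ₗ X ≫ evEnd C X) : f = g := internalHom_ext h

/-- The algebra structure on `[X, X]`. -/
instance internalEndMonObj : MonObj (internalEnd C X) where
  one := endOne C X
  mul := endMul C X
  one_mul := by
    apply internalEnd_ext
    rw [comp_actionHomLeft, Category.assoc, endMul_ev, whiskerRight_actionHomLeft]
    simp only [Category.assoc, Iso.inv_hom_id_assoc]
    rw [← action_exchange_assoc, endOne_ev, ← actionUnitIso_hom_naturality,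
      leftUnitor_actionHom, Category.assoc]
  mul_one := by
    apply internalEnd_ext
    rw [comp_actionHomLeft, Category.assoc, endMul_ev, whiskerLeft_actionHomLeft]
    simp only [Category.assoc, Iso.inv_hom_id_assoc]
    rw [← actionHomRight_comp_assoc, endOne_ev, rightUnitor_actionHom, Category.assoc]
  mul_assoc := by
    apply internalEnd_ext
    simp only [comp_actionHomLeft, Category.assoc, endMul_ev, whiskerLeft_actionHomLeft,
      whiskerRight_actionHomLeft, Iso.inv_hom_id_assoc]
    rw [← action_exchange_assoc, endMul_ev, ← actionHomRight_comp_assoc _ (endMul C X ⊵ₗ X),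
      endMul_ev]
    simp only [actionHomRight_comp, Category.assoc, tensor_actionHomRight, Iso.inv_hom_id_assoc]
    rw [← associator_actionHom_assoc]

end Closed

section Coclosed

variable (X : M) [IsCoclosedObject C X]

/-- The internal cohom `[X, -]`, left adjoint to `V ↦ V ⊙ₗ X`. -/
def internalCohom : M ⥤ C := (actionRight C X).leftAdjoint

/-- The adjunction defining the internal cohom. -/
def internalCohomAdj : internalCohom C X ⊣ actionRight C X :=
  Adjunction.ofIsRightAdjoint (actionRight C X)

/-- The coevaluation `Y ⟶ [X, Y] ⊙ₗ X`. -/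
def coev (Y : M) : Y ⟶ (internalCohom C X).obj Y ⊙ₗ X := (internalCohomAdj C X).unit.app Y

/-- The morphism `[X, Y] ⟶ V` corresponding to `Y ⟶ V ⊙ₗ X`. -/
def cocurry {V : C} {Y : M} (f : Y ⟶ V ⊙ₗ X) : (internalCohom C X).obj Y ⟶ V :=
  ((internalCohomAdj C X).homEquiv Y V).symm f

@[simp]
lemma coev_cocurry {V : C} {Y : M} (f : Y ⟶ V ⊙ₗ X) :
    coev C X Y ≫ cocurry C X f ⊵ₗ X = f := by
  exact ((internalCohomAdj C X).homEquiv_unit (f := cocurry C X f)).symm.trans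
    (((internalCohomAdj C X).homEquiv Y V).apply_symm_apply f)

variable {C X} in
lemma internalCohom_ext {V : C} {Y : M} {f g : (internalCohom C X).obj Y ⟶ V}
    (h : coev C X Y ≫ f ⊵ₗ X = coev C X Y ≫ g ⊵ₗ X) : f = g := by
  apply ((internalCohomAdj C X).homEquiv Y V).injective
  rw [Adjunction.homEquiv_unit, Adjunction.homEquiv_unit]
  exact h

/-- The object `[X, X]` for the internal cohom. -/
def internalCoend : C := (internalCohom C X).obj X

/-- The coevaluation `X ⟶ [X, X] ⊙ₗ X`. -/
def coevCoend : X ⟶ internalCoend C X ⊙ₗ X := coev C X X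

/-- The counit of `[X, X]`, corresponding to `X ≅ 𝟙 ⊙ₗ X`. -/
def coendCounit : internalCoend C X ⟶ 𝟙_ C := cocurry C X (λₗ X).inv

/-- The comultiplication of `[X, X]`, corresponding to the iterated coevaluation
`X ⟶ [X, X] ⊙ₗ X ⟶ [X, X] ⊙ₗ [X, X] ⊙ₗ X ≅ ([X, X] ⊗ [X, X]) ⊙ₗ X`. -/
def coendComul : internalCoend C X ⟶ internalCoend C X ⊗ internalCoend C X :=
  cocurry C X (coev C X X ≫ internalCoend C X ⊴ₗ coev C X X ≫
    (αₗ (internalCoend C X) (internalCoend C X) X).inv)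

lemma coev_coendCounit : coevCoend C X ≫ coendCounit C X ⊵ₗ X = (λₗ X).inv :=
  coev_cocurry C X _

lemma coev_coendComul : coevCoend C X ≫ coendComul C X ⊵ₗ X =
    coevCoend C X ≫ internalCoend C X ⊴ₗ coevCoend C X ≫
      (αₗ (internalCoend C X) (internalCoend C X) X).inv := coev_cocurry C X _

variable {C X} in
lemma internalCoend_ext {V : C} {f g : internalCoend C X ⟶ V}
    (h : coevCoend C X ≫ f ⊵ₗ X = coevCoend C X ≫ g ⊵ₗ X) : f = g := internalCohom_ext h

/-- The coalgebra structure on `[X, X]`. -/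
instance internalCoendComonObj : ComonObj (internalCoend C X) where
  counit := coendCounit C X
  comul := coendComul C X
  counit_comul := by
    apply internalCoend_ext
    rw [comp_actionHomLeft, reassoc_of% coev_coendComul, whiskerRight_actionHomLeft]
    simp only [Iso.inv_hom_id_assoc]
    rw [action_exchange_assoc, reassoc_of% coev_coendCounit, actionUnitIso_inv_naturality_assoc,
      ← cancel_mono ((λ_ (internalCoend C X)).hom ⊵ₗ X)]
    simp only [Category.assoc, inv_hom_actionHomLeft]
    simp
  comul_counit := by
    apply internalCoend_ext
    rw [comp_actionHomLeft, reassoc_of% coev_coendComul, whiskerLeft_actionHomLeft]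
    simp only [Iso.inv_hom_id_assoc]
    rw [← actionHomRight_comp_assoc, coev_coendCounit,
      ← cancel_mono ((ρ_ (internalCoend C X)).hom ⊵ₗ X)]
    simp only [Category.assoc, inv_hom_actionHomLeft]
    simp
  comul_assoc := by
    apply internalCoend_ext
    simp only [comp_actionHomLeft, reassoc_of% coev_coendComul, whiskerLeft_actionHomLeft,
      whiskerRight_actionHomLeft, Iso.inv_hom_id_assoc, Category.assoc]
    rw [action_exchange_assoc, reassoc_of% coev_coendComul,
      ← actionHomRight_comp_assoc _ (coevCoend C X) (coendComul C X ⊵ₗ X), coev_coendComul]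
    simp only [actionHomRight_comp, Category.assoc, tensor_actionHomRight, Iso.inv_hom_id_assoc]
    congr 3
    rw [← cancel_epi (internalCoend C X ⊴ₗ (αₗ (internalCoend C X) (internalCoend C X) X).hom)]
    simp only [actionHomRight_hom_inv_assoc]
    rw [← cancel_epi (αₗ (internalCoend C X) (internalCoend C X ⊗ internalCoend C X) X).hom,
      ← cancel_epi ((α_ (internalCoend C X) (internalCoend C X) (internalCoend C X)).hom ⊵ₗ X),
      associator_actionHom_assoc]
    simp only [Iso.hom_inv_id, Iso.hom_inv_id_assoc, Category.comp_id]

end Coclosed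

end InternalHom

/-! ### Right modules over an algebra object -/

section Modules

variable {C : Type u₁} [Category.{v₁} C] [MonoidalCategory C]

open scoped MonObj ComonObj

/-- A right module over the algebra object `A`. -/
structure RMod (A : C) [MonObj A] where
  /-- The underlying object. -/
  X : C
  /-- The action. -/
  act : X ⊗ A ⟶ X
  act_one : X ◁ η[A] ≫ act = (ρ_ X).hom
  act_mul : X ◁ μ[A] ≫ act = (α_ X A A).inv ≫ act ▷ A ≫ act

namespace RMod

attribute [simp] act_one act_mul

variable {A : C} [MonObj A]

/-- Morphisms of right modules. -/
@[ext]
structure Hom (P Q : RMod A) where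
  /-- The underlying morphism. -/
  hom : P.X ⟶ Q.X
  act_hom : P.act ≫ hom = hom ▷ A ≫ Q.act := by cat_disch

attribute [simp] Hom.act_hom

instance : Category (RMod A) where
  Hom P Q := Hom P Q
  id P := { hom := 𝟙 P.X }
  comp f g :=
    { hom := f.hom ≫ g.hom
      act_hom := by
        rw [reassoc_of% f.act_hom, g.act_hom, comp_whiskerRight, Category.assoc] }

@[simp] lemma id_hom (P : RMod A) : Hom.hom (𝟙 P) = 𝟙 P.X := rfl

@[simp] lemma comp_hom {P Q R : RMod A} (f : P ⟶ Q) (g : Q ⟶ R) :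
    (f ≫ g).hom = f.hom ≫ g.hom := rfl

@[ext] lemma hom_ext {P Q : RMod A} {f g : P ⟶ Q} (h : f.hom = g.hom) : f = g := Hom.ext h

/-- An isomorphism of right modules from an isomorphism of the underlying objects. -/
@[simps]
def mkIso {P Q : RMod A} (e : P.X ≅ Q.X) (h : P.act ≫ e.hom = e.hom ▷ A ≫ Q.act) : P ≅ Q where
  hom := { hom := e.hom, act_hom := h }
  inv := { hom := e.inv, act_hom := by
            rw [Iso.comp_inv_eq, Category.assoc, h, ← comp_whiskerRight_assoc]; simp }

/-- The right module `V ⊗ P`, for a right module `P`. -/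
@[simps]
abbrev tensor (V : C) (P : RMod A) : RMod A where
  X := V ⊗ P.X
  act := (α_ V P.X A).hom ≫ V ◁ P.act
  act_one := by
    rw [tensor_whiskerLeft]
    simp only [Category.assoc, Iso.inv_hom_id_assoc]
    rw [← whiskerLeft_comp, act_one]
    simp
  act_mul := by
    rw [tensor_whiskerLeft]
    simp only [Category.assoc, Iso.inv_hom_id_assoc]
    rw [← whiskerLeft_comp, act_mul]
    simp

/-- The left `C`-module structure on right `A`-modules, with `V ⊙ₗ P` being `V ⊗ P`. -/
instance : MonoidalLeftAction C (RMod A) where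
  actionObj V P := tensor V P
  actionHomLeft {V W} f P :=
    { hom := f ▷ P.X
      act_hom := by
        change ((α_ V P.X A).hom ≫ V ◁ P.act) ≫ f ▷ P.X =
          (f ▷ P.X) ▷ A ≫ (α_ W P.X A).hom ≫ W ◁ P.act
        rw [Category.assoc, whisker_exchange]
        simp }
  actionHomRight V P Q f :=
    { hom := V ◁ f.hom
      act_hom := by
        change ((α_ V P.X A).hom ≫ V ◁ P.act) ≫ V ◁ f.hom =
          (V ◁ f.hom) ▷ A ≫ (α_ V Q.X A).hom ≫ V ◁ Q.act
        rw [Category.assoc, ← whiskerLeft_comp, f.act_hom]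
        simp }
  actionAssocIso V W P := mkIso (α_ V W P.X) (by
    simp only [tensor_X]
    simp)
  actionUnitIso P := mkIso (λ_ P.X) (by
    simp only [tensor_X]
    simp)
  actionHom_comp {c c' c'' d d' d''} f₁ f₂ g₁ g₂ := hom_ext (by
    change (f₁ ≫ f₂) ▷ d.X ≫ c'' ◁ (g₁.hom ≫ g₂.hom) =
      (f₁ ▷ d.X ≫ c' ◁ g₁.hom) ≫ f₂ ▷ d'.X ≫ c'' ◁ g₂.hom
    simp [whisker_exchange_assoc])
  actionAssocIso_hom_naturality {c₁ c₂ c₃ c₄ d₁ d₂} f g h := hom_ext (by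
    change ((f ⊗ₘ g) ▷ d₁.X ≫ (c₂ ⊗ c₄) ◁ h.hom) ≫ (α_ c₂ c₄ d₂.X).hom =
      (α_ c₁ c₃ d₁.X).hom ≫ f ▷ (c₃ ⊗ d₁.X) ≫ c₂ ◁ (g ▷ d₁.X ≫ c₄ ◁ h.hom)
    simp [MonoidalCategory.tensorHom_def])

section Linear

variable [Preadditive C] [MonoidalPreadditive C]

instance (P Q : RMod A) : Add (P ⟶ Q) := ⟨fun f g => { hom := f.hom + g.hom }⟩

instance (P Q : RMod A) : Zero (P ⟶ Q) := ⟨{ hom := 0 }⟩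

instance (P Q : RMod A) : Neg (P ⟶ Q) := ⟨fun f =>
  { hom := -f.hom
    act_hom := by
      have : (-f.hom) ▷ A = -(f.hom ▷ A) := (tensorRight A).map_neg
      simp [this] }⟩

instance (P Q : RMod A) : AddCommGroup (P ⟶ Q) where
  add_assoc _ _ _ := hom_ext (add_assoc _ _ _)
  zero_add _ := hom_ext (zero_add _)
  add_zero _ := hom_ext (add_zero _)
  neg_add_cancel _ := hom_ext (neg_add_cancel _)
  add_comm _ _ := hom_ext (add_comm _ _)
  nsmul := nsmulRec
  zsmul := zsmulRec

@[simp] lemma add_hom {P Q : RMod A} (f g : P ⟶ Q) : (f + g).hom = f.hom + g.hom := rfl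

/-- Right modules form a preadditive category, morphisms being added in `C`. -/
instance : Preadditive (RMod A) where
  add_comp _ _ _ _ _ _ := hom_ext (Preadditive.add_comp _ _ _ _ _ _)
  comp_add _ _ _ _ _ _ := hom_ext (Preadditive.comp_add _ _ _ _ _ _)

variable {k : Type w} [Field k] [Linear k C] [MonoidalLinear k C]

instance (P Q : RMod A) : Module k (P ⟶ Q) where
  smul a f := { hom := a • f.hom }
  one_smul _ := hom_ext (one_smul _ _)
  mul_smul _ _ _ := hom_ext (mul_smul _ _ _)
  smul_zero _ := hom_ext (smul_zero _)
  smul_add _ _ _ := hom_ext (smul_add _ _ _)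
  add_smul _ _ _ := hom_ext (add_smul _ _ _)
  zero_smul _ := hom_ext (zero_smul _ _)

@[simp] lemma smul_hom {P Q : RMod A} (a : k) (f : P ⟶ Q) : (a • f).hom = a • f.hom := rfl

/-- Right modules form a `k`-linear category, morphisms being rescaled in `C`. -/
instance : Linear k (RMod A) where
  smul_comp _ _ _ _ _ _ := hom_ext (Linear.smul_comp _ _ _ _ _ _)
  comp_smul _ _ _ _ _ _ := hom_ext (Linear.comp_smul _ _ _ _ _ _)

end Linear

end RMod

/-! ### Right comodules over a coalgebra object -/

/-- A right comodule over the coalgebra object `K`. -/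
structure RComod (K : C) [ComonObj K] where
  /-- The underlying object. -/
  X : C
  /-- The coaction. -/
  coact : X ⟶ X ⊗ K
  coact_counit : coact ≫ X ◁ ε[K] = (ρ_ X).inv
  coact_comul : coact ≫ X ◁ Δ[K] = coact ≫ coact ▷ K ≫ (α_ X K K).hom

namespace RComod

attribute [simp] coact_counit coact_comul

variable {K : C} [ComonObj K]

/-- Morphisms of right comodules. -/
@[ext]
structure Hom (P Q : RComod K) where
  /-- The underlying morphism. -/
  hom : P.X ⟶ Q.X
  hom_coact : hom ≫ Q.coact = P.coact ≫ hom ▷ K := by cat_disch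

attribute [simp] Hom.hom_coact

instance : Category (RComod K) where
  Hom P Q := Hom P Q
  id P := { hom := 𝟙 P.X }
  comp f g :=
    { hom := f.hom ≫ g.hom
      hom_coact := by
        rw [Category.assoc, g.hom_coact, reassoc_of% f.hom_coact, comp_whiskerRight] }

@[simp] lemma id_hom (P : RComod K) : Hom.hom (𝟙 P) = 𝟙 P.X := rfl

@[simp] lemma comp_hom {P Q R : RComod K} (f : P ⟶ Q) (g : Q ⟶ R) :
    (f ≫ g).hom = f.hom ≫ g.hom := rfl

@[ext] lemma hom_ext {P Q : RComod K} {f g : P ⟶ Q} (h : f.hom = g.hom) : f = g := Hom.ext h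

/-- An isomorphism of right comodules from an isomorphism of the underlying objects. -/
@[simps]
def mkIso {P Q : RComod K} (e : P.X ≅ Q.X) (h : e.hom ≫ Q.coact = P.coact ≫ e.hom ▷ K) :
    P ≅ Q where
  hom := { hom := e.hom, hom_coact := h }
  inv := { hom := e.inv, hom_coact := by
            rw [Iso.inv_comp_eq, reassoc_of% h, ← comp_whiskerRight]; simp }

/-- The right comodule `V ⊗ P`, for a right comodule `P`. -/
@[simps]
abbrev tensor (V : C) (P : RComod K) : RComod K where
  X := V ⊗ P.X
  coact := V ◁ P.coact ≫ (α_ V P.X K).inv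
  coact_counit := by
    rw [tensor_whiskerLeft]
    simp only [Category.assoc, Iso.inv_hom_id_assoc]
    rw [← whiskerLeft_comp_assoc, coact_counit]
    simp
  coact_comul := by
    rw [tensor_whiskerLeft]
    simp only [Category.assoc, Iso.inv_hom_id_assoc]
    rw [← whiskerLeft_comp_assoc, coact_comul]
    simp

/-- The left `C`-module structure on right `K`-comodules, with `V ⊙ₗ P` being `V ⊗ P`. -/
instance : MonoidalLeftAction C (RComod K) where
  actionObj V P := tensor V P
  actionHomLeft {V W} f P :=
    { hom := f ▷ P.X
      hom_coact := by
        change f ▷ P.X ≫ W ◁ P.coact ≫ (α_ W P.X K).inv =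
          (V ◁ P.coact ≫ (α_ V P.X K).inv) ≫ (f ▷ P.X) ▷ K
        rw [← whisker_exchange_assoc]
        simp }
  actionHomRight V P Q f :=
    { hom := V ◁ f.hom
      hom_coact := by
        change V ◁ f.hom ≫ V ◁ Q.coact ≫ (α_ V Q.X K).inv =
          (V ◁ P.coact ≫ (α_ V P.X K).inv) ≫ (V ◁ f.hom) ▷ K
        rw [← whiskerLeft_comp_assoc, f.hom_coact]
        simp }
  actionAssocIso V W P := mkIso (α_ V W P.X) (by
    simp only [tensor_X]
    simp)
  actionUnitIso P := mkIso (λ_ P.X) (by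
    simp only [tensor_X]
    simp)
  actionHom_comp {c c' c'' d d' d''} f₁ f₂ g₁ g₂ := hom_ext (by
    change (f₁ ≫ f₂) ▷ d.X ≫ c'' ◁ (g₁.hom ≫ g₂.hom) =
      (f₁ ▷ d.X ≫ c' ◁ g₁.hom) ≫ f₂ ▷ d'.X ≫ c'' ◁ g₂.hom
    simp [whisker_exchange_assoc])
  actionAssocIso_hom_naturality {c₁ c₂ c₃ c₄ d₁ d₂} f g h := hom_ext (by
    change ((f ⊗ₘ g) ▷ d₁.X ≫ (c₂ ⊗ c₄) ◁ h.hom) ≫ (α_ c₂ c₄ d₂.X).hom =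
      (α_ c₁ c₃ d₁.X).hom ≫ f ▷ (c₃ ⊗ d₁.X) ≫ c₂ ◁ (g ▷ d₁.X ≫ c₄ ◁ h.hom)
    simp [MonoidalCategory.tensorHom_def])

section Linear

variable [Preadditive C] [MonoidalPreadditive C]

instance (P Q : RComod K) : Add (P ⟶ Q) := ⟨fun f g => { hom := f.hom + g.hom }⟩

instance (P Q : RComod K) : Zero (P ⟶ Q) := ⟨{ hom := 0 }⟩

instance (P Q : RComod K) : Neg (P ⟶ Q) := ⟨fun f =>
  { hom := -f.hom
    hom_coact := by
      have : (-f.hom) ▷ K = -(f.hom ▷ K) := (tensorRight K).map_neg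
      simp [this] }⟩

instance (P Q : RComod K) : AddCommGroup (P ⟶ Q) where
  add_assoc _ _ _ := hom_ext (add_assoc _ _ _)
  zero_add _ := hom_ext (zero_add _)
  add_zero _ := hom_ext (add_zero _)
  neg_add_cancel _ := hom_ext (neg_add_cancel _)
  add_comm _ _ := hom_ext (add_comm _ _)
  nsmul := nsmulRec
  zsmul := zsmulRec

@[simp] lemma add_hom {P Q : RComod K} (f g : P ⟶ Q) : (f + g).hom = f.hom + g.hom := rfl

/-- Right comodules form a preadditive category, morphisms being added in `C`. -/
instance : Preadditive (RComod K) where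
  add_comp _ _ _ _ _ _ := hom_ext (Preadditive.add_comp _ _ _ _ _ _)
  comp_add _ _ _ _ _ _ := hom_ext (Preadditive.comp_add _ _ _ _ _ _)

variable {k : Type w} [Field k] [Linear k C] [MonoidalLinear k C]

instance (P Q : RComod K) : Module k (P ⟶ Q) where
  smul a f := { hom := a • f.hom }
  one_smul _ := hom_ext (one_smul _ _)
  mul_smul _ _ _ := hom_ext (mul_smul _ _ _)
  smul_zero _ := hom_ext (smul_zero _)
  smul_add _ _ _ := hom_ext (smul_add _ _ _)
  add_smul _ _ _ := hom_ext (add_smul _ _ _)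
  zero_smul _ := hom_ext (zero_smul _ _)

@[simp] lemma smul_hom {P Q : RComod K} (a : k) (f : P ⟶ Q) : (a • f).hom = a • f.hom := rfl

/-- Right comodules form a `k`-linear category, morphisms being rescaled in `C`. -/
instance : Linear k (RComod K) where
  smul_comp _ _ _ _ _ _ := hom_ext (Linear.smul_comp _ _ _ _ _ _)
  comp_smul _ _ _ _ _ _ := hom_ext (Linear.comp_smul _ _ _ _ _ _)

end Linear

end RComod

end Modules

end

end ModuleCategory

namespace ModuleCategory

/-! ### Duality in `C` acting on `M`. -/

section ActionDuality

variable {C : Type u₁} [Category.{v₁} C] [MonoidalCategory C]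
  {M : Type u₂} [Category.{v₂} M] [MonoidalLeftAction C M]

/-! Write `A = [X, X]`. The equivalence is the inverse of the functor `[X, -]` from `M` to right
`A`-modules, where `A` acts by iterated evaluation.

Rigidity enters through one bijection, `tensorEv_bijective`: morphisms `W ⟶ V ⊗ [X, Y]` are the same
as morphisms `W ⊙ₗ X ⟶ V ⊙ₗ Y`, by moving `V` to the other side as a dual and applying the
adjunction. By Yoneda it makes `V ⊗ [X, Y] ⟶ [X, V ⊙ₗ Y]` invertible, so `[X, -]` is a `C`-module
functor. For `Y = X` it says that the objects `V ⊙ₗ X` have the same morphisms as the free modules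
`V ⊗ A`, so maps between them can be replaced by maps in `C`, where the module axioms apply.

The generator property makes every evaluation `[X, Y] ⊙ₗ X ⟶ Y` epi, so every object of `M` has a
presentation by objects `V ⊙ₗ X`; full faithfulness follows. `C`-projectivity gives essential
surjectivity: for a module `P`, let `Y` be the relative tensor product of `P` and `X`, the cokernel
of the difference of the two maps `(P ⊗ A) ⊙ₗ X ⟶ P ⊙ₗ X`. Testing on projectives `Q` of `C`, maps
out of `Q ⊙ₗ X` lift, which shows that `P ⟶ [X, Y]` is both epi and mono. Exactness of `[X, -]` is
never needed.

The coalgebra statement has the dual proof: monic coevaluations, kernels and injectives. -/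

lemma associator_hom_actionHomLeft (U V W : C) (Y : M) :
    (α_ U V W).hom ⊵ₗ Y = (αₗ (U ⊗ V) W Y).hom ≫ (αₗ U V (W ⊙ₗ Y)).hom ≫
      U ⊴ₗ (αₗ V W Y).inv ≫ (αₗ U (V ⊗ W) Y).inv := by
  rw [← associator_actionHom_assoc]
  simp

lemma associator_inv_actionHomLeft (U V W : C) (Y : M) :
    (α_ U V W).inv ⊵ₗ Y = (αₗ U (V ⊗ W) Y).hom ≫ U ⊴ₗ (αₗ V W Y).hom ≫
      (αₗ U V (W ⊙ₗ Y)).inv ≫ (αₗ (U ⊗ V) W Y).inv := by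
  rw [← cancel_epi ((α_ U V W).hom ⊵ₗ Y)]
  rw [associator_actionHom_assoc]
  simp

lemma leftUnitor_inv_actionHomLeft (V : C) (Y : M) :
    (λ_ V).inv ⊵ₗ Y = (λₗ (V ⊙ₗ Y)).inv ≫ (αₗ (𝟙_ C) V Y).inv := by
  rw [← cancel_mono ((λ_ V).hom ⊵ₗ Y), inv_hom_actionHomLeft]
  simp

lemma rightUnitor_inv_actionHomLeft (V : C) (Y : M) :
    (ρ_ V).inv ⊵ₗ Y = V ⊴ₗ (λₗ Y).inv ≫ (αₗ V (𝟙_ C) Y).inv := by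
  rw [← cancel_mono ((ρ_ V).hom ⊵ₗ Y), inv_hom_actionHomLeft]
  simp

/-- For a dual pair `(V, V')`, the functor `V' ⊙ₗ -` is left adjoint to `V ⊙ₗ -`. -/
def actionLeftHomEquiv (V V' : C) [ExactPairing V V'] (Y Z : M) :
    (V' ⊙ₗ Y ⟶ Z) ≃ (Y ⟶ V ⊙ₗ Z) where
  toFun f := (λₗ Y).inv ≫ η_ V V' ⊵ₗ Y ≫ (αₗ V V' Y).hom ≫ V ⊴ₗ f
  invFun g := V' ⊴ₗ g ≫ (αₗ V' V Z).inv ≫ ε_ V V' ⊵ₗ Z ≫ (λₗ Z).hom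
  left_inv f := by
    -- A triangle identity of the dual pair, acting on `Y` and followed by `f`; its right side
    -- collapses to `f`, and its left side is the round trip up to interchange.
    have h := congr((ρ_ V').inv ⊵ₗ Y ≫
      $(ExactPairing.coevaluation_evaluation V V') ⊵ₗ Y ≫ (λ_ V').hom ⊵ₗ Y ≫ f)
    simp only [comp_actionHomLeft, Category.assoc,
      whiskerLeft_actionHomLeft, whiskerRight_actionHomLeft, associator_inv_actionHomLeft,
      rightUnitor_inv_actionHomLeft, leftUnitor_actionHom, Iso.inv_hom_id_assoc,
      leftUnitor_inv_actionHomLeft, rightUnitor_actionHom, actionHomRight_inv_hom_assoc] at h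
    refine Eq.trans ?_ h
    rw [actionUnitIso_hom_naturality, ← action_exchange_assoc]
    simp only [actionHomRight_comp, Category.assoc, tensor_actionHomRight, Iso.inv_hom_id_assoc]
  right_inv g := by
    have h := congr(g ≫ (λ_ V).inv ⊵ₗ Z ≫
      $(ExactPairing.evaluation_coevaluation V V') ⊵ₗ Z ≫ (ρ_ V).hom ⊵ₗ Z)
    simp only [comp_actionHomLeft, Category.assoc,
      whiskerLeft_actionHomLeft, whiskerRight_actionHomLeft, leftUnitor_inv_actionHomLeft,
      rightUnitor_actionHom, Iso.inv_hom_id_assoc, leftUnitor_actionHom,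
      rightUnitor_inv_actionHomLeft, actionHomRight_inv_hom, Iso.inv_hom_id,
      Category.comp_id] at h
    refine Eq.trans ?_ h
    rw [← actionUnitIso_inv_naturality_assoc, action_exchange_assoc]
    simp only [actionHomRight_comp, Category.assoc, tensor_actionHomRight, Iso.inv_hom_id_assoc,
      associator_hom_actionHomLeft]

end ActionDuality

/-! ### Strong module functors and their inverses. -/

section Linear

open Functor

variable {C : Type u₁} [Category.{v₁} C] [MonoidalCategory C]
  {M : Type u₂} [Category.{v₂} M] [MonoidalLeftAction C M]
  {N : Type u₃} [Category.{v₃} N] [MonoidalLeftAction C N]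

open LaxLeftLinear OplaxLeftLinear

/-- A lax linear functor with invertible lineators is linear. -/
@[reducible] noncomputable def leftLinearOfIsIsoLax (F : M ⥤ N) [F.LaxLeftLinear C]
    [∀ (V : C) (Y : M), IsIso (μₗ F V Y)] : F.LeftLinear C where
  δₗ V Y := inv (μₗ F V Y)
  δₗ_naturality_left f Y := by
    rw [IsIso.eq_inv_comp, ← μₗ_naturality_left_assoc, IsIso.hom_inv_id, Category.comp_id]
  δₗ_naturality_right V _ _ f := by
    rw [IsIso.eq_inv_comp, ← μₗ_naturality_right_assoc, IsIso.hom_inv_id, Category.comp_id]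
  δₗ_associativity V W Y := by
    rw [IsIso.inv_comp_eq, μₗ_associativity_assoc]
    simp [← actionHomRight_comp]
  δₗ_unitality_inv Y := by
    rw [IsIso.eq_comp_inv, μₗ_unitality_inv]
  μₗ_comp_δₗ := by simp
  δₗ_comp_μₗ := by simp

/-- An oplax linear functor with invertible lineators is linear. -/
@[reducible] noncomputable def leftLinearOfIsIsoOplax (F : M ⥤ N) [F.OplaxLeftLinear C]
    [∀ (V : C) (Y : M), IsIso (δₗ F V Y)] : F.LeftLinear C where
  μₗ V Y := inv (δₗ F V Y)
  μₗ_naturality_left f Y := by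
    rw [IsIso.eq_inv_comp, ← δₗ_naturality_left_assoc, IsIso.hom_inv_id, Category.comp_id]
  μₗ_naturality_right V _ _ f := by
    rw [IsIso.eq_inv_comp, ← δₗ_naturality_right_assoc, IsIso.hom_inv_id, Category.comp_id]
  μₗ_associativity V W Y := by
    rw [IsIso.inv_comp_eq, δₗ_associativity_assoc]
    simp [← actionHomRight_comp_assoc]
  μₗ_unitality Y := by
    rw [IsIso.eq_inv_comp, δₗ_unitality_hom]
  μₗ_comp_δₗ := by simp
  δₗ_comp_μₗ := by simp

/-- The right adjoint of an oplax linear functor is lax linear. -/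
@[reducible] def laxLeftLinearOfAdjunction {F : M ⥤ N} {G : N ⥤ M} (adj : F ⊣ G)
    [F.OplaxLeftLinear C] : G.LaxLeftLinear C where
  μₗ V Y := adj.homEquiv _ _ (δₗ F V (G.obj Y) ≫ V ⊴ₗ adj.counit.app Y)
  μₗ_naturality_left f Y := by
    rw [← adj.homEquiv_naturality_left, ← adj.homEquiv_naturality_right]
    simp [action_exchange]
  μₗ_naturality_right V _ _ f := by
    rw [← adj.homEquiv_naturality_left, ← adj.homEquiv_naturality_right]
    simp [← actionHomRight_comp]
  μₗ_associativity V W Y := by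
    rw [← adj.homEquiv_naturality_right]
    apply (adj.homEquiv _ _).symm.injective
    rw [Equiv.symm_apply_apply]
    rw [adj.homEquiv_naturality_left_symm, adj.homEquiv_naturality_left_symm]
    rw [Equiv.symm_apply_apply, δₗ_naturality_right_assoc, ← actionHomRight_comp]
    erw [← Adjunction.homEquiv_counit, Equiv.symm_apply_apply]
    simp
  μₗ_unitality Y := by
    rw [← adj.homEquiv_naturality_right]
    apply (adj.homEquiv _ _).symm.injective
    simp [Adjunction.homEquiv_counit]

/-- The inverse of a linear equivalence is linear. -/
@[reducible] noncomputable def leftLinearInverse (e : M ≌ N) [e.functor.LeftLinear C] :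
    e.inverse.LeftLinear C :=
  letI := laxLeftLinearOfAdjunction (C := C) e.toAdjunction
  have (V : C) (Y : N) : IsIso (μₗ e.inverse V Y) := by
    -- The lineator is the unit followed by the image of an inverse lineator and of the counit; all
    -- are invertible for an equivalence.
    change IsIso (e.toAdjunction.homEquiv _ _ _)
    rw [Adjunction.homEquiv_unit]
    simp only [Equivalence.toAdjunction_counit, Equivalence.toAdjunction_unit]
    infer_instance
  leftLinearOfIsIsoLax e.inverse

/-- The direction is reversed on purpose: `[X, -]` starts at `M`, while the required equivalence
ends there. -/
theorem ModuleEquivalent.of_isEquivalence (k : Type w) [Field k] [Preadditive M] [Linear k M]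
    [Preadditive N] [Linear k N] (F : M ⥤ N) [F.IsEquivalence] [F.Additive] [F.Linear k]
    [F.LeftLinear C] : ModuleEquivalent k C N M := by
  obtain ⟨e, rfl⟩ : ∃ e : M ≌ N, e.functor = F := ⟨F.asEquivalence, rfl⟩
  exact ⟨e.symm, e.inverse_additive, e.inverseLinear k, ⟨leftLinearInverse e⟩⟩

end Linear

noncomputable section

open scoped MonObj ComonObj

lemma RMod.isIso_of_isIso_hom {C : Type u₁} [Category.{v₁} C] [MonoidalCategory C] {A : C}
    [MonObj A] {P Q : RMod A} (f : P ⟶ Q) [IsIso f.hom] : IsIso f :=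
  (mkIso (asIso f.hom) f.act_hom).isIso_hom

/-! ### The module functor `[X, -]` into right `[X, X]`-modules. -/

section Closed

variable (C : Type u₁) [Category.{v₁} C] [MonoidalCategory C]
  {M : Type u₂} [Category.{v₂} M] [MonoidalLeftAction C M]
  (X : M) [IsClosedObject C X]

lemma internalHom_map_ev {Y Z : M} (f : Y ⟶ Z) :
    (internalHom C X).map f ⊵ₗ X ≫ ev C X Z = ev C X Y ≫ f :=
  (internalHomAdj C X).counit.naturality f

/-- Evaluation `W ⟶ V ⊗ [X, Y] ↦ W ⊙ₗ X ⟶ V ⊙ₗ Y` is bijective when `C` is rigid. -/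
lemma tensorEv_bijective [RigidCategory C] (V W : C) (Y : M) :
    Function.Bijective (fun s : W ⟶ V ⊗ (internalHom C X).obj Y =>
      s ⊵ₗ X ≫ (αₗ V _ X).hom ≫ V ⊴ₗ ev C X Y) := by
  -- Pass to `Vᘁ ⊗ W ⟶ [X, Y]`, then `(Vᘁ ⊗ W) ⊙ₗ X ⟶ Y`, then `Vᘁ ⊙ₗ W ⊙ₗ X ⟶ Y`, then `W ⊙ₗ X ⟶ V
  -- ⊙ₗ Y`. What remains is to see that the composite is the evaluation formula.
  let e := (tensorLeftHomEquiv W V Vᘁ ((internalHom C X).obj Y)).symm.trans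
    (((internalHomAdj C X).homEquiv _ _).symm.trans
      (((αₗ Vᘁ W X).homCongr (Iso.refl Y)).trans (actionLeftHomEquiv V Vᘁ (W ⊙ₗ X) Y)))
  convert e.bijective with s
  obtain ⟨f, rfl⟩ := (tensorLeftHomEquiv W V Vᘁ _).surjective s
  change _ = actionLeftHomEquiv V Vᘁ (W ⊙ₗ X) Y ((αₗ Vᘁ W X).homCongr (Iso.refl Y)
    (((internalHomAdj C X).homEquiv _ _).symm ((tensorLeftHomEquiv W V Vᘁ _).symm
      (tensorLeftHomEquiv W V Vᘁ _ f))))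
  rw [Equiv.symm_apply_apply, Adjunction.homEquiv_counit]
  change _ = actionLeftHomEquiv V Vᘁ (W ⊙ₗ X) Y ((αₗ Vᘁ W X).inv ≫ (f ⊵ₗ X ≫ ev C X Y) ≫ 𝟙 Y)
  simp only [tensorLeftHomEquiv, actionLeftHomEquiv, Equiv.coe_fn_mk,
    comp_actionHomLeft, Category.assoc, leftUnitor_inv_actionHomLeft, whiskerLeft_actionHomLeft,
    whiskerRight_actionHomLeft, Iso.inv_hom_id_assoc, Category.comp_id,
    associator_hom_actionHomLeft, actionHomRight_comp]

/-- The free-module case `Y = X`, through which fullness and essential surjectivity replace maps in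
`M` by maps in `C`. -/
lemma tensorEvEnd_bijective [RigidCategory C] (V W : C) :
    Function.Bijective (fun s : W ⟶ V ⊗ internalEnd C X =>
      s ⊵ₗ X ≫ (αₗ V (internalEnd C X) X).hom ≫ V ⊴ₗ evEnd C X) :=
  tensorEv_bijective C X V W X

/-- The right action of `[X, X]` on `[X, Y]`, corresponding to the iterated evaluation. -/
def homAct (Y : M) : (internalHom C X).obj Y ⊗ internalEnd C X ⟶ (internalHom C X).obj Y :=
  curry C X ((αₗ ((internalHom C X).obj Y) (internalEnd C X) X).hom ≫
    (internalHom C X).obj Y ⊴ₗ evEnd C X ≫ ev C X Y)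

lemma homAct_ev (Y : M) : homAct C X Y ⊵ₗ X ≫ ev C X Y =
    (αₗ ((internalHom C X).obj Y) (internalEnd C X) X).hom ≫
      (internalHom C X).obj Y ⊴ₗ evEnd C X ≫ ev C X Y := curry_ev C X _

lemma one_ev : η[internalEnd C X] ⊵ₗ X ≫ evEnd C X = (λₗ X).hom := endOne_ev C X

lemma mul_ev : μ[internalEnd C X] ⊵ₗ X ≫ evEnd C X =
    (αₗ (internalEnd C X) (internalEnd C X) X).hom ≫
      internalEnd C X ⊴ₗ evEnd C X ≫ evEnd C X := endMul_ev C X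

/-- The right `[X, X]`-module `[X, Y]`. -/
def homModule (Y : M) : RMod (internalEnd C X) where
  X := (internalHom C X).obj Y
  act := homAct C X Y
  act_one := by
    apply internalHom_ext
    simp only [comp_actionHomLeft, Category.assoc, homAct_ev, whiskerLeft_actionHomLeft,
      Iso.inv_hom_id_assoc]
    rw [← actionHomRight_comp_assoc, one_ev, rightUnitor_actionHom, Category.assoc]
  act_mul := by
    apply internalHom_ext
    simp only [comp_actionHomLeft, Category.assoc, homAct_ev, whiskerLeft_actionHomLeft,
      whiskerRight_actionHomLeft, Iso.inv_hom_id_assoc, associator_inv_actionHomLeft]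
    rw [← action_exchange_assoc, homAct_ev, ← actionHomRight_comp_assoc _ (μ ⊵ₗ X), mul_ev]
    simp

lemma homAct_map {Y Z : M} (f : Y ⟶ Z) :
    homAct C X Y ≫ (internalHom C X).map f =
      (internalHom C X).map f ▷ internalEnd C X ≫ homAct C X Z := by
  apply internalHom_ext
  simp only [comp_actionHomLeft, Category.assoc, homAct_ev,
    internalHom_map_ev, reassoc_of% homAct_ev, whiskerRight_actionHomLeft, Iso.inv_hom_id_assoc]
  rw [← action_exchange_assoc, internalHom_map_ev]

/-- The functor `[X, -]` to right `[X, X]`-modules. -/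
def homModuleFunctor : M ⥤ RMod (internalEnd C X) where
  obj Y := homModule C X Y
  map f := { hom := (internalHom C X).map f, act_hom := homAct_map C X f }
  map_id Y := RMod.hom_ext ((internalHom C X).map_id Y)
  map_comp f g := RMod.hom_ext ((internalHom C X).map_comp f g)

/-- The comparison morphism `V ⊗ [X, Y] ⟶ [X, V ⊙ₗ Y]`. -/
def homTensor (V : C) (Y : M) : V ⊗ (internalHom C X).obj Y ⟶ (internalHom C X).obj (V ⊙ₗ Y) :=
  curry C X ((αₗ V _ X).hom ≫ V ⊴ₗ ev C X Y)

lemma homTensor_ev (V : C) (Y : M) : homTensor C X V Y ⊵ₗ X ≫ ev C X (V ⊙ₗ Y) =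
    (αₗ V ((internalHom C X).obj Y) X).hom ≫ V ⊴ₗ ev C X Y := curry_ev C X _

lemma homTensor_act (V : C) (Y : M) :
    ((α_ V ((internalHom C X).obj Y) (internalEnd C X)).hom ≫ V ◁ homAct C X Y) ≫
        homTensor C X V Y =
      homTensor C X V Y ▷ internalEnd C X ≫ homAct C X (V ⊙ₗ Y) := by
  apply internalHom_ext
  simp only [comp_actionHomLeft, Category.assoc, homAct_ev, homTensor_ev,
    whiskerRight_actionHomLeft, Iso.inv_hom_id_assoc, whiskerLeft_actionHomLeft]
  rw [← action_exchange_assoc, homTensor_ev, ← actionHomRight_comp, homAct_ev]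
  simp [associator_hom_actionHomLeft]

/-- The lax `C`-module structure of the functor `[X, -]`. -/
instance : (homModuleFunctor C X).LaxLeftLinear C where
  μₗ V Y := { hom := homTensor C X V Y, act_hom := homTensor_act C X V Y }
  μₗ_naturality_left {V W} f Y := by
    apply RMod.hom_ext
    change f ▷ (internalHom C X).obj Y ≫ homTensor C X W Y =
      homTensor C X V Y ≫ (internalHom C X).map (f ⊵ₗ Y)
    apply internalHom_ext
    simp [homTensor_ev, reassoc_of% homTensor_ev, internalHom_map_ev, action_exchange,
      whiskerRight_actionHomLeft, -actionHomLeft_action]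
  μₗ_naturality_right V Y Z f := by
    apply RMod.hom_ext
    change V ◁ (internalHom C X).map f ≫ homTensor C X V Z =
      homTensor C X V Y ≫ (internalHom C X).map (V ⊴ₗ f)
    apply internalHom_ext
    simp [homTensor_ev, reassoc_of% homTensor_ev, internalHom_map_ev, ← actionHomRight_comp]
  μₗ_associativity V W Y := by
    apply RMod.hom_ext
    change homTensor C X (V ⊗ W) Y ≫ (internalHom C X).map (αₗ V W Y).hom =
      (α_ V W _).hom ≫ V ◁ homTensor C X W Y ≫ homTensor C X V (W ⊙ₗ Y)
    apply internalHom_ext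
    simp [homTensor_ev, reassoc_of% homTensor_ev, internalHom_map_ev, ← actionHomRight_comp]
    rw [actionHomRight_comp, associator_actionHom_assoc]
  μₗ_unitality Y := by
    apply RMod.hom_ext
    change (λ_ _).hom = homTensor C X (𝟙_ C) Y ≫ (internalHom C X).map (λₗ Y).hom
    apply internalHom_ext
    simp [reassoc_of% homTensor_ev, internalHom_map_ev]

/-- Yoneda: composing with `homTensor` is the bijection of `tensorEv_bijective` followed by the
adjunction. A preimage of the identity is a right inverse, and injectivity makes it two-sided. -/
instance isIso_homTensor [RigidCategory C] (V : C) (Y : M) : IsIso (homTensor C X V Y) := by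
  have key (W : C) : Function.Bijective (fun s : W ⟶ V ⊗ (internalHom C X).obj Y =>
      s ≫ homTensor C X V Y) := by
    have := ((internalHomAdj C X).homEquiv W (V ⊙ₗ Y)).bijective.comp
      (tensorEv_bijective C X V W Y)
    convert this
    apply internalHom_ext
    erw [curry_ev]
    simp [homTensor_ev]
  obtain ⟨s, hs⟩ := (key _).2 (𝟙 _)
  refine ⟨s, (key _).1 ?_, hs⟩
  simpa using homTensor C X V Y ≫= hs

open Functor in
instance [RigidCategory C] (V : C) (Y : M) :
    IsIso (LaxLeftLinear.μₗ (homModuleFunctor C X) V Y) :=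
  have : IsIso (LaxLeftLinear.μₗ (homModuleFunctor C X) V Y).hom := isIso_homTensor C X V Y
  RMod.isIso_of_isIso_hom _

instance [RigidCategory C] : (homModuleFunctor C X).LeftLinear C := leftLinearOfIsIsoLax _

end Closed

/-! ### `k`-linearity of `[X, -]` on modules. -/

section Bilinear

variable (k : Type w) [Field k]
  {C : Type u₁} [Category.{v₁} C] [Preadditive C] [Linear k C] [MonoidalCategory C]
  {M : Type u₂} [Category.{v₂} M] [Preadditive M] [Linear k M] [MonoidalLeftAction C M]

lemma zero_actionHomLeft [BilinearAction k C M] (V W : C) (Y : M) :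
    (0 : V ⟶ W) ⊵ₗ Y = 0 := by
  simpa using BilinearAction.smul_actionHomLeft (0 : k) (0 : V ⟶ W) Y

lemma sub_actionHomLeft [BilinearAction k C M] {V W : C} (f g : V ⟶ W) (Y : M) :
    (f - g) ⊵ₗ Y = f ⊵ₗ Y - g ⊵ₗ Y := by
  rw [eq_sub_iff_add_eq, ← BilinearAction.add_actionHomLeft k, sub_add_cancel]

lemma homModuleFunctor_additive [MonoidalPreadditive C] [BilinearAction k C M]
    (X : M) [IsClosedObject C X] : (homModuleFunctor C X).Additive where
  map_add {Y Z f g} := by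
    apply RMod.hom_ext
    change (internalHom C X).map (f + g) = (internalHom C X).map f + (internalHom C X).map g
    apply internalHom_ext
    simp [internalHom_map_ev, BilinearAction.add_actionHomLeft (k := k)]

lemma homModuleFunctor_linear [MonoidalPreadditive C] [MonoidalLinear k C] [BilinearAction k C M]
    (X : M) [IsClosedObject C X] : (homModuleFunctor C X).Linear k where
  map_smul f a := by
    apply RMod.hom_ext
    change (internalHom C X).map (a • f) = a • (internalHom C X).map f
    apply internalHom_ext
    simp [internalHom_map_ev, BilinearAction.smul_actionHomLeft (k := k)]

end Bilinear

/-! ### The projective case: `[X, -]` is an equivalence. -/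

section Closed

variable (k : Type w) [Field k]
  {C : Type u₁} [Category.{v₁} C] [MonoidalCategory C]
  {M : Type u₂} [Category.{v₂} M] [Abelian M] [MonoidalLeftAction C M]
  {X : M} [IsClosedObject C X]

/-- A projective covering `Y` is a summand of some `P ⊙ₗ X`, and the resulting epi `P ⊙ₗ X ⟶ Y`
factors through evaluation. -/
lemma IsCProjectiveCGenerator.epi_ev [EnoughProjectives M]
    (hX : IsCProjectiveCGenerator C X) (Y : M) : Epi (ev C X Y) := by
  obtain ⟨P, -, Q', ⟨e⟩⟩ := hX.2 (Projective.over Y) inferInstance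
  exact epi_of_epi_fac (curry_ev C X (e.hom ≫ biprod.fst ≫ Projective.π Y))

lemma IsCProjectiveCGenerator.faithful [EnoughProjectives M]
    (hX : IsCProjectiveCGenerator C X) : (homModuleFunctor C X).Faithful where
  map_injective {Y Z f g} h := by
    have := hX.epi_ev Y
    rw [← cancel_epi (ev C X Y), ← internalHom_map_ev, ← internalHom_map_ev]
    exact congr($(congr(RMod.Hom.hom $h)) ⊵ₗ X ≫ ev C X Z)

/-- A homomorphism of modules `[X, Y] ⟶ [X, Z]` annihilates the relations of `Y`. -/
lemma comp_homModule_hom_ev [Abelian C] [Linear k C] [Linear k M] [BilinearAction k C M]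
    [RigidCategory C] {W : C} {Y Z : M} (h : homModule C X Y ⟶ homModule C X Z)
    (t : W ⊙ₗ X ⟶ (internalHom C X).obj Y ⊙ₗ X) (ht : t ≫ ev C X Y = 0) :
    t ≫ h.hom ⊵ₗ X ≫ ev C X Z = 0 := by
  obtain ⟨s, rfl⟩ := (tensorEvEnd_bijective C X _ W).2 t
  -- The transpose of `s ≫ homAct` is `t ≫ ev`, so a relation of `Y` becomes one that any module
  -- homomorphism preserves.
  have hs : s ≫ homAct C X Y = 0 := by
    apply internalHom_ext
    rw [zero_actionHomLeft k, zero_comp, ← ht]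
    simp [homAct_ev]
  obtain ⟨f, hf⟩ : ∃ f : (internalHom C X).obj Y ⟶ (internalHom C X).obj Z, f = h.hom := ⟨_, rfl⟩
  have hact : homAct C X Y ≫ f = f ▷ internalEnd C X ≫ homAct C X Z := by
    rw [hf]
    exact h.act_hom
  have := congr((s ≫ $hact) ⊵ₗ X ≫ ev C X Z)
  rw [reassoc_of% hs, zero_comp, zero_actionHomLeft k, zero_comp] at this
  simp only [comp_actionHomLeft, Category.assoc, homAct_ev, whiskerRight_actionHomLeft,
    Iso.inv_hom_id_assoc] at this
  rw [← action_exchange_assoc, hf] at this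
  simp only [Category.assoc]
  exact this.symm

/-- Evaluation at `Y` is the cokernel of its kernel, so the transpose of `h` descends to `Y` once it
kills that kernel. -/
lemma IsCProjectiveCGenerator.full [Abelian C] [Linear k C] [Linear k M] [BilinearAction k C M]
    [RigidCategory C] [EnoughProjectives M] (hX : IsCProjectiveCGenerator C X) :
    (homModuleFunctor C X).Full where
  map_surjective {Y Z} h := by
    have := hX.epi_ev Y
    -- Covering the kernel by an object `W ⊙ₗ X` allows `comp_homModule_hom_ev` to apply.
    have := hX.epi_ev (kernel (ev C X Y))
    have hι : kernel.ι (ev C X Y) ≫ h.hom ⊵ₗ X ≫ ev C X Z = 0 := by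
      rw [← cancel_epi (ev C X (kernel (ev C X Y))), comp_zero, ← Category.assoc]
      exact comp_homModule_hom_ev k h _ (by simp)
    let l := Abelian.epiIsCokernelOfKernel _ (kernelIsKernel (ev C X Y))
    refine ⟨l.desc (CokernelCofork.ofπ _ hι), ?_⟩
    apply RMod.hom_ext
    apply internalHom_ext
    refine (internalHom_map_ev C X _).trans ?_
    exact l.fac _ WalkingParallelPair.one

section EssSurj

variable (P : RMod (internalEnd C X))

/-- The relations imposed on `P ⊙ₗ X` to obtain the relative tensor product of `P` with `X`. -/
abbrev moduleRel : (P.X ⊗ internalEnd C X) ⊙ₗ X ⟶ P.X ⊙ₗ X :=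
  P.act ⊵ₗ X - (αₗ P.X (internalEnd C X) X).hom ≫ P.X ⊴ₗ evEnd C X

/-- The canonical morphism from a module `P` to `[X, Y]`, for `Y` the relative tensor product of
`P` with `X`. -/
abbrev moduleUnit : P.X ⟶ (internalHom C X).obj (cokernel (moduleRel P)) :=
  curry C X (cokernel.π (moduleRel P))

/-- After transposition this is the defining relation of the cokernel. -/
lemma moduleUnit_act : P.act ≫ moduleUnit P =
    moduleUnit P ▷ internalEnd C X ≫ homAct C X (cokernel (moduleRel P)) := by
  apply internalHom_ext
  simp only [comp_actionHomLeft, Category.assoc, homAct_ev, whiskerRight_actionHomLeft,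
    Iso.inv_hom_id_assoc]
  rw [← action_exchange_assoc, curry_ev, ← sub_eq_zero]
  simpa only [Preadditive.sub_comp, Category.assoc] using cokernel.condition (moduleRel P)

/-- A projective cover of `[X, Y]` factors through `moduleUnit`: its transpose lifts along the
cokernel projection to `P.X ⊙ₗ X`, the lift comes from a map `s` into `P.X ⊗ A`, and `s ≫ P.act` is
the factorization. -/
lemma IsCProjective.epi_moduleUnit [RigidCategory C] [EnoughProjectives C]
    (hX : IsCProjective C X) : Epi (moduleUnit P) := by
  let Y := cokernel (moduleRel P)
  have := hX _ (Projective.projective_over ((internalHom C X).obj Y))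
  let g := Projective.π ((internalHom C X).obj Y) ⊵ₗ X ≫ ev C X Y
  obtain ⟨s, hs⟩ := (tensorEvEnd_bijective C X _ _).2
    (Projective.factorThru g (cokernel.π (moduleRel P)))
  refine epi_of_epi_fac (f := s ≫ P.act) (h := Projective.π _) ?_
  apply internalHom_ext
  refine Eq.trans ?_ (Projective.factorThru_comp g (cokernel.π (moduleRel P)))
  rw [← hs, comp_actionHomLeft, Category.assoc, curry_ev]
  have := cokernel.condition (moduleRel P)
  rw [Preadditive.sub_comp, sub_eq_zero] at this
  simp only [comp_actionHomLeft, Category.assoc, this]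

/-- If `r` from a projective dies in `[X, Y]`, then `r ⊵ₗ X` lifts through the relations. The lift
comes from a map `s` into `(P.X ⊗ A) ⊗ A`, and associativity of the action forces `r = 0`. -/
lemma IsCProjective.mono_moduleUnit [Abelian C] [MonoidalPreadditive C] [Linear k C] [Linear k M]
    [BilinearAction k C M] [RigidCategory C] [EnoughProjectives C]
    (hX : IsCProjective C X) : Mono (moduleUnit P) := by
  refine Preadditive.mono_of_cancel_zero _ fun {W} t ht => ?_
  rw [← cancel_epi (Projective.π W), comp_zero]
  obtain ⟨r, hr⟩ : ∃ r, r = Projective.π W ≫ t := ⟨_, rfl⟩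
  rw [← hr]
  have hq : r ⊵ₗ X ≫ cokernel.π (moduleRel P) = 0 := by
    have := congr((Projective.π W ≫ $ht) ⊵ₗ X ≫ ev C X _)
    rwa [comp_zero, zero_actionHomLeft k, zero_comp, ← Category.assoc, ← hr,
      comp_actionHomLeft, Category.assoc, curry_ev] at this
  have := hX _ (Projective.projective_over W)
  have ex : (ShortComplex.mk _ _ (cokernel.condition (moduleRel P))).Exact :=
    ShortComplex.exact_cokernel _
  obtain ⟨s, hs⟩ := (tensorEvEnd_bijective C X _ _).2 (ex.liftFromProjective _ hq)
  have hu := ex.liftFromProjective_comp _ hq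
  rw [← hs] at hu
  -- Both sides correspond to `r ⊵ₗ X`: the left because `s` lifts it through `moduleRel`, the right
  -- by the unit of `A`.
  have key : s ≫ P.act ▷ internalEnd C X - s ≫ (α_ _ _ _).hom ≫ P.X ◁ μ[internalEnd C X] =
      r ≫ (ρ_ _).inv ≫ P.X ◁ η[internalEnd C X] := by
    apply (tensorEvEnd_bijective C X _ _).1
    dsimp only
    rw [sub_actionHomLeft k, Preadditive.sub_comp]
    have hη : (r ≫ (ρ_ _).inv ≫ P.X ◁ η[internalEnd C X]) ⊵ₗ X ≫
        (αₗ P.X (internalEnd C X) X).hom ≫ P.X ⊴ₗ evEnd C X = r ⊵ₗ X := by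
      simp only [comp_actionHomLeft, Category.assoc, whiskerLeft_actionHomLeft,
        Iso.inv_hom_id_assoc, rightUnitor_inv_actionHomLeft]
      rw [← actionHomRight_comp, one_ev, actionHomRight_inv_hom, Category.comp_id]
    rw [hη, ← hu]
    simp only [comp_actionHomLeft, Category.assoc, whiskerLeft_actionHomLeft,
      whiskerRight_actionHomLeft, Iso.inv_hom_id_assoc, Preadditive.comp_sub,
      associator_hom_actionHomLeft]
    rw [← action_exchange, ← actionHomRight_comp _ (μ[internalEnd C X] ⊵ₗ X), mul_ev]
    simp
  -- The action kills the left side by associativity and turns the right side into `r` by unitality.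
  have := congr($key ≫ P.act)
  simpa using this.symm

end EssSurj

lemma IsCProjective.essSurj [Abelian C] [MonoidalPreadditive C] [Linear k C] [Linear k M]
    [BilinearAction k C M] [RigidCategory C] [EnoughProjectives C]
    (hX : IsCProjective C X) : (homModuleFunctor C X).EssSurj where
  mem_essImage P := by
    have := hX.epi_moduleUnit P
    have := hX.mono_moduleUnit k P
    have := isIso_of_mono_of_epi (moduleUnit P)
    let e : P.X ≅ (internalHom C X).obj (cokernel (moduleRel P)) := asIso (moduleUnit P)
    exact ⟨cokernel (moduleRel P), ⟨(RMod.mkIso (Q := homModule C X (cokernel (moduleRel P)))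
      e (moduleUnit_act P)).symm⟩⟩

theorem moduleEquivalent_of_isCProjectiveCGenerator [Abelian C] [Linear k C]
    [MonoidalPreadditive C] [MonoidalLinear k C] [RigidCategory C] [Linear k M]
    [BilinearAction k C M] [EnoughProjectives C] [EnoughProjectives M]
    (hX : IsCProjectiveCGenerator C X) : ModuleEquivalent k C (RMod (internalEnd C X)) M := by
  have := hX.faithful
  have := hX.full k
  have := hX.1.essSurj k
  have : (homModuleFunctor C X).IsEquivalence := {}
  have := homModuleFunctor_additive k (C := C) X
  have := homModuleFunctor_linear k (C := C) X
  exact ModuleEquivalent.of_isEquivalence k (homModuleFunctor C X)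

end Closed

/-! ### The module functor `[X, -]` into right `[X, X]`-comodules. -/

section Coclosed

lemma RComod.isIso_of_isIso_hom {C : Type u₁} [Category.{v₁} C] [MonoidalCategory C] {K : C}
    [ComonObj K] {P Q : RComod K} (f : P ⟶ Q) [IsIso f.hom] : IsIso f :=
  (mkIso (asIso f.hom) f.hom_coact).isIso_hom

variable (C : Type u₁) [Category.{v₁} C] [MonoidalCategory C]
  {M : Type u₂} [Category.{v₂} M] [MonoidalLeftAction C M]
  (X : M) [IsCoclosedObject C X]

lemma coev_internalCohom_map {Y Z : M} (f : Y ⟶ Z) :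
    coev C X Y ≫ (internalCohom C X).map f ⊵ₗ X = f ≫ coev C X Z :=
  ((internalCohomAdj C X).unit.naturality f).symm

/-- Coevaluation `V ⊗ [X, Y] ⟶ W ↦ V ⊙ₗ Y ⟶ W ⊙ₗ X` is bijective when `C` is rigid. -/
lemma tensorCoev_bijective [RigidCategory C] (V W : C) (Y : M) :
    Function.Bijective (fun s : V ⊗ (internalCohom C X).obj Y ⟶ W =>
      V ⊴ₗ coev C X Y ≫ (αₗ V _ X).inv ≫ s ⊵ₗ X) := by
  -- Now `V` leaves the source, so it is the left dual that appears on the target side.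
  let e := (tensorLeftHomEquiv ((internalCohom C X).obj Y) (ᘁV : C) V W).trans
    (((internalCohomAdj C X).homEquiv _ _).trans
      (((Iso.refl Y).homCongr (αₗ (ᘁV : C) W X)).trans
        (actionLeftHomEquiv (ᘁV : C) V Y (W ⊙ₗ X)).symm))
  convert e.bijective with s
  obtain ⟨f, rfl⟩ := (tensorLeftHomEquiv _ (ᘁV : C) V W).symm.surjective s
  change _ = (actionLeftHomEquiv (ᘁV : C) V Y (W ⊙ₗ X)).symm
    ((Iso.refl Y).homCongr (αₗ (ᘁV : C) W X) ((internalCohomAdj C X).homEquiv _ _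
      (tensorLeftHomEquiv _ (ᘁV : C) V W ((tensorLeftHomEquiv _ (ᘁV : C) V W).symm f))))
  rw [Equiv.apply_symm_apply, Adjunction.homEquiv_unit]
  change _ = (actionLeftHomEquiv (ᘁV : C) V Y (W ⊙ₗ X)).symm
    (𝟙 Y ≫ (coev C X Y ≫ f ⊵ₗ X) ≫ (αₗ (ᘁV : C) W X).hom)
  simp only [tensorLeftHomEquiv, actionLeftHomEquiv, Equiv.coe_fn_symm_mk,
    comp_actionHomLeft, Category.assoc, leftUnitor_actionHom, whiskerLeft_actionHomLeft,
    whiskerRight_actionHomLeft, Iso.inv_hom_id_assoc, Category.id_comp,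
    associator_inv_actionHomLeft, actionHomRight_comp]

lemma tensorCoevCoend_bijective [RigidCategory C] (V W : C) :
    Function.Bijective (fun s : V ⊗ internalCoend C X ⟶ W =>
      V ⊴ₗ coevCoend C X ≫ (αₗ V (internalCoend C X) X).inv ≫ s ⊵ₗ X) :=
  tensorCoev_bijective C X V W X

/-- The right coaction of `[X, X]` on `[X, Y]`, corresponding to the iterated coevaluation. -/
def cohomCoact (Y : M) :
    (internalCohom C X).obj Y ⟶ (internalCohom C X).obj Y ⊗ internalCoend C X :=
  cocurry C X (coev C X Y ≫ (internalCohom C X).obj Y ⊴ₗ coevCoend C X ≫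
    (αₗ ((internalCohom C X).obj Y) (internalCoend C X) X).inv)

lemma coev_cohomCoact (Y : M) : coev C X Y ≫ cohomCoact C X Y ⊵ₗ X =
    coev C X Y ≫ (internalCohom C X).obj Y ⊴ₗ coevCoend C X ≫
      (αₗ ((internalCohom C X).obj Y) (internalCoend C X) X).inv := coev_cocurry C X _

lemma coev_counit : coevCoend C X ≫ ε[internalCoend C X] ⊵ₗ X = (λₗ X).inv :=
  coev_coendCounit C X

lemma coev_comul : coevCoend C X ≫ Δ[internalCoend C X] ⊵ₗ X =
    coevCoend C X ≫ internalCoend C X ⊴ₗ coevCoend C X ≫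
      (αₗ (internalCoend C X) (internalCoend C X) X).inv := coev_coendComul C X

/-- The right `[X, X]`-comodule `[X, Y]`. -/
def cohomComodule (Y : M) : RComod (internalCoend C X) where
  X := (internalCohom C X).obj Y
  coact := cohomCoact C X Y
  coact_counit := by
    apply internalCohom_ext
    simp only [comp_actionHomLeft, reassoc_of% coev_cohomCoact,
      whiskerLeft_actionHomLeft, Iso.inv_hom_id_assoc]
    rw [← actionHomRight_comp_assoc, coev_counit, rightUnitor_inv_actionHomLeft]
  coact_comul := by
    apply internalCohom_ext
    simp only [comp_actionHomLeft, Category.assoc, reassoc_of% coev_cohomCoact,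
      whiskerLeft_actionHomLeft, whiskerRight_actionHomLeft, Iso.inv_hom_id_assoc,
      associator_hom_actionHomLeft]
    rw [action_exchange_assoc, reassoc_of% coev_cohomCoact,
      ← actionHomRight_comp_assoc _ _ (Δ ⊵ₗ X), coev_comul]
    simp

lemma map_cohomCoact {Y Z : M} (f : Y ⟶ Z) :
    (internalCohom C X).map f ≫ cohomCoact C X Z =
      cohomCoact C X Y ≫ (internalCohom C X).map f ▷ internalCoend C X := by
  apply internalCohom_ext
  simp only [comp_actionHomLeft, coev_cohomCoact, reassoc_of% coev_cohomCoact,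
    reassoc_of% coev_internalCohom_map, whiskerRight_actionHomLeft, Iso.inv_hom_id_assoc]
  rw [action_exchange_assoc, reassoc_of% coev_internalCohom_map]

/-- The functor `[X, -]` to right `[X, X]`-comodules. -/
def cohomComoduleFunctor : M ⥤ RComod (internalCoend C X) where
  obj Y := cohomComodule C X Y
  map f := { hom := (internalCohom C X).map f, hom_coact := map_cohomCoact C X f }
  map_id Y := RComod.hom_ext ((internalCohom C X).map_id Y)
  map_comp f g := RComod.hom_ext ((internalCohom C X).map_comp f g)

/-- The comparison morphism `[X, V ⊙ₗ Y] ⟶ V ⊗ [X, Y]`. -/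
def cohomTensor (V : C) (Y : M) :
    (internalCohom C X).obj (V ⊙ₗ Y) ⟶ V ⊗ (internalCohom C X).obj Y :=
  cocurry C X (V ⊴ₗ coev C X Y ≫ (αₗ V _ X).inv)

lemma coev_cohomTensor (V : C) (Y : M) : coev C X (V ⊙ₗ Y) ≫ cohomTensor C X V Y ⊵ₗ X =
    V ⊴ₗ coev C X Y ≫ (αₗ V ((internalCohom C X).obj Y) X).inv := coev_cocurry C X _

lemma cohomTensor_coact (V : C) (Y : M) :
    cohomTensor C X V Y ≫
        V ◁ cohomCoact C X Y ≫ (α_ V ((internalCohom C X).obj Y) (internalCoend C X)).inv =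
      cohomCoact C X (V ⊙ₗ Y) ≫ cohomTensor C X V Y ▷ internalCoend C X := by
  apply internalCohom_ext
  simp only [comp_actionHomLeft, Category.assoc, reassoc_of% coev_cohomCoact,
    reassoc_of% coev_cohomTensor,
    whiskerRight_actionHomLeft, Iso.inv_hom_id_assoc, whiskerLeft_actionHomLeft]
  rw [action_exchange_assoc, reassoc_of% coev_cohomTensor, ← actionHomRight_comp_assoc,
    coev_cohomCoact]
  simp [associator_inv_actionHomLeft]

/-- The oplax `C`-module structure of the functor `[X, -]`. -/
instance : (cohomComoduleFunctor C X).OplaxLeftLinear C where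
  δₗ V Y := { hom := cohomTensor C X V Y, hom_coact := cohomTensor_coact C X V Y }
  δₗ_naturality_left {V W} f Y := by
    apply RComod.hom_ext
    change (internalCohom C X).map (f ⊵ₗ Y) ≫ cohomTensor C X W Y =
      cohomTensor C X V Y ≫ f ▷ (internalCohom C X).obj Y
    apply internalCohom_ext
    simp [coev_cohomTensor, reassoc_of% coev_cohomTensor, reassoc_of% coev_internalCohom_map,
      action_exchange_assoc, whiskerRight_actionHomLeft, -actionHomLeft_action]
  δₗ_naturality_right V Y Z f := by
    apply RComod.hom_ext
    change (internalCohom C X).map (V ⊴ₗ f) ≫ cohomTensor C X V Z =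
      cohomTensor C X V Y ≫ V ◁ (internalCohom C X).map f
    apply internalCohom_ext
    simp only [comp_actionHomLeft, coev_cohomTensor, reassoc_of% coev_cohomTensor,
      reassoc_of% coev_internalCohom_map, whiskerLeft_actionHomLeft, Iso.inv_hom_id_assoc]
    rw [← actionHomRight_comp_assoc, ← actionHomRight_comp_assoc, coev_internalCohom_map]
  δₗ_associativity V W Y := by
    apply RComod.hom_ext
    change cohomTensor C X (V ⊗ W) Y ≫ (α_ V W _).hom =
      (internalCohom C X).map (αₗ V W Y).hom ≫ cohomTensor C X V (W ⊙ₗ Y) ≫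
        V ◁ cohomTensor C X W Y
    apply internalCohom_ext
    simp only [comp_actionHomLeft, reassoc_of% coev_cohomTensor,
      reassoc_of% coev_internalCohom_map, whiskerLeft_actionHomLeft, Iso.inv_hom_id_assoc]
    rw [← actionHomRight_comp_assoc, coev_cohomTensor]
    simp [associator_hom_actionHomLeft]
  δₗ_unitality_inv Y := by
    apply RComod.hom_ext
    change (λ_ _).inv = (internalCohom C X).map (λₗ Y).inv ≫ cohomTensor C X (𝟙_ C) Y
    apply internalCohom_ext
    simp [coev_cohomTensor, reassoc_of% coev_internalCohom_map, leftUnitor_inv_actionHomLeft]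

/-- Yoneda again, with precomposition in place of postcomposition. -/
instance isIso_cohomTensor [RigidCategory C] (V : C) (Y : M) : IsIso (cohomTensor C X V Y) := by
  have key (W : C) : Function.Bijective (fun s : V ⊗ (internalCohom C X).obj Y ⟶ W =>
      cohomTensor C X V Y ≫ s) := by
    have := ((internalCohomAdj C X).homEquiv (V ⊙ₗ Y) W).symm.bijective.comp
      (tensorCoev_bijective C X V W Y)
    convert this
    apply internalCohom_ext
    erw [coev_cocurry]
    simp [reassoc_of% coev_cohomTensor]
  obtain ⟨s, hs⟩ := (key _).2 (𝟙 _)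
  refine ⟨s, hs, (key _).1 ?_⟩
  simpa using hs =≫ cohomTensor C X V Y

open Functor in
instance [RigidCategory C] (V : C) (Y : M) :
    IsIso (OplaxLeftLinear.δₗ (cohomComoduleFunctor C X) V Y) :=
  have : IsIso (OplaxLeftLinear.δₗ (cohomComoduleFunctor C X) V Y).hom := isIso_cohomTensor C X V Y
  RComod.isIso_of_isIso_hom _

instance [RigidCategory C] : (cohomComoduleFunctor C X).LeftLinear C := leftLinearOfIsIsoOplax _

end Coclosed

/-! ### `k`-linearity of `[X, -]` on comodules. -/

section Bilinear

variable (k : Type w) [Field k]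
  {C : Type u₁} [Category.{v₁} C] [Preadditive C] [Linear k C] [MonoidalCategory C]
  {M : Type u₂} [Category.{v₂} M] [Preadditive M] [Linear k M] [MonoidalLeftAction C M]

lemma cohomComoduleFunctor_additive [MonoidalPreadditive C] [BilinearAction k C M]
    (X : M) [IsCoclosedObject C X] : (cohomComoduleFunctor C X).Additive where
  map_add {Y Z f g} := by
    apply RComod.hom_ext
    change (internalCohom C X).map (f + g) = (internalCohom C X).map f + (internalCohom C X).map g
    apply internalCohom_ext
    simp [coev_internalCohom_map, BilinearAction.add_actionHomLeft (k := k)]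

lemma cohomComoduleFunctor_linear [MonoidalPreadditive C] [MonoidalLinear k C]
    [BilinearAction k C M] (X : M) [IsCoclosedObject C X] :
    (cohomComoduleFunctor C X).Linear k where
  map_smul f a := by
    apply RComod.hom_ext
    change (internalCohom C X).map (a • f) = a • (internalCohom C X).map f
    apply internalCohom_ext
    simp [coev_internalCohom_map, BilinearAction.smul_actionHomLeft (k := k)]

end Bilinear

/-! ### The injective case: `[X, -]` is an equivalence. -/

section Coclosed

variable (k : Type w) [Field k]
  {C : Type u₁} [Category.{v₁} C] [MonoidalCategory C]
  {M : Type u₂} [Category.{v₂} M] [Abelian M] [MonoidalLeftAction C M]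
  {X : M} [IsCoclosedObject C X]

/-- `Y` embeds in an injective, hence in some `I ⊙ₗ X`, and this embedding factors through
coevaluation. -/
lemma IsCInjectiveCCogenerator.mono_coev [EnoughInjectives M]
    (hX : IsCInjectiveCCogenerator C X) (Y : M) : Mono (coev C X Y) := by
  obtain ⟨I, -, J', ⟨e⟩⟩ := hX.2 (Injective.under Y) inferInstance
  exact mono_of_mono_fac (coev_cocurry C X (Injective.ι Y ≫ biprod.inl ≫ e.inv))

lemma IsCInjectiveCCogenerator.faithful [EnoughInjectives M]
    (hX : IsCInjectiveCCogenerator C X) : (cohomComoduleFunctor C X).Faithful where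
  map_injective {Y Z f g} h := by
    have := hX.mono_coev Z
    rw [← cancel_mono (coev C X Z), ← coev_internalCohom_map, ← coev_internalCohom_map]
    exact congr(coev C X Y ≫ $(congr(RComod.Hom.hom $h)) ⊵ₗ X)

/-- A homomorphism of comodules `[X, Y] ⟶ [X, Z]` respects the corelations of `Z`. -/
lemma coev_cohomComodule_hom_comp [Abelian C] [Linear k C] [Linear k M] [BilinearAction k C M]
    [RigidCategory C] {W : C} {Y Z : M} (h : cohomComodule C X Y ⟶ cohomComodule C X Z)
    (t : (internalCohom C X).obj Z ⊙ₗ X ⟶ W ⊙ₗ X) (ht : coev C X Z ≫ t = 0) :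
    coev C X Y ≫ h.hom ⊵ₗ X ≫ t = 0 := by
  obtain ⟨s, rfl⟩ := (tensorCoevCoend_bijective C X _ W).2 t
  have hs : cohomCoact C X Z ≫ s = 0 := by
    apply internalCohom_ext
    rw [zero_actionHomLeft k, comp_zero, ← ht]
    simp [reassoc_of% coev_cohomCoact]
  obtain ⟨f, hf⟩ : ∃ f : (internalCohom C X).obj Y ⟶ (internalCohom C X).obj Z, f = h.hom :=
    ⟨_, rfl⟩
  have hcoact : f ≫ cohomCoact C X Z = cohomCoact C X Y ≫ f ▷ internalCoend C X := by
    rw [hf]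
    exact h.hom_coact
  have := congr(coev C X Y ≫ ($hcoact ≫ s) ⊵ₗ X)
  rw [Category.assoc, hs, comp_zero, zero_actionHomLeft k, comp_zero] at this
  simp only [comp_actionHomLeft, Category.assoc, reassoc_of% coev_cohomCoact,
    whiskerRight_actionHomLeft, Iso.inv_hom_id_assoc] at this
  rw [action_exchange_assoc, hf] at this
  exact this.symm

lemma IsCInjectiveCCogenerator.full [Abelian C] [Linear k C] [Linear k M] [BilinearAction k C M]
    [RigidCategory C] [EnoughInjectives M] (hX : IsCInjectiveCCogenerator C X) :
    (cohomComoduleFunctor C X).Full where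
  map_surjective {Y Z} h := by
    have := hX.mono_coev Z
    have := hX.mono_coev (cokernel (coev C X Z))
    obtain ⟨f, hf⟩ : ∃ f : (internalCohom C X).obj Y ⟶ (internalCohom C X).obj Z, f = h.hom :=
      ⟨_, rfl⟩
    -- The cokernel embeds by its own coevaluation in an object `W ⊙ₗ X`, where vanishing can be
    -- tested; the map then lifts to `Z`, the kernel of this cokernel.
    have hπ : (coev C X Y ≫ f ⊵ₗ X) ≫ cokernel.π (coev C X Z) = 0 := by
      rw [← cancel_mono (coev C X (cokernel (coev C X Z))), zero_comp, Category.assoc,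
        Category.assoc, hf]
      exact coev_cohomComodule_hom_comp k h _ (by simp)
    let l := Abelian.monoIsKernelOfCokernel _ (cokernelIsCokernel (coev C X Z))
    refine ⟨l.lift (KernelFork.ofι _ hπ), ?_⟩
    apply RComod.hom_ext
    refine Eq.trans ?_ hf
    apply internalCohom_ext
    refine (coev_internalCohom_map C X _).trans ?_
    exact l.fac _ WalkingParallelPair.zero

section EssSurj

variable (P : RComod (internalCoend C X))

/-- The corelations imposed on `P ⊙ₗ X` to obtain the relative cotensor product of `P` with
`X`. -/
abbrev comoduleRel : P.X ⊙ₗ X ⟶ (P.X ⊗ internalCoend C X) ⊙ₗ X :=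
  P.coact ⊵ₗ X - P.X ⊴ₗ coevCoend C X ≫ (αₗ P.X (internalCoend C X) X).inv

/-- The canonical morphism from `[X, Y]` to a comodule `P`, for `Y` the relative cotensor product
of `P` with `X`. -/
abbrev comoduleCounit : (internalCohom C X).obj (kernel (comoduleRel P)) ⟶ P.X :=
  cocurry C X (kernel.ι (comoduleRel P))

lemma comoduleCounit_coact : comoduleCounit P ≫ P.coact =
    cohomCoact C X (kernel (comoduleRel P)) ≫ comoduleCounit P ▷ internalCoend C X := by
  apply internalCohom_ext
  simp only [comp_actionHomLeft, reassoc_of% coev_cohomCoact,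
    whiskerRight_actionHomLeft, Iso.inv_hom_id_assoc]
  rw [action_exchange_assoc, reassoc_of% coev_cocurry, reassoc_of% coev_cocurry, ← sub_eq_zero]
  simpa only [Preadditive.comp_sub, Category.assoc] using kernel.condition (comoduleRel P)

/-- An embedding of `[X, Y]` in an injective `I` extends along `comoduleCounit`: its transpose
extends from the kernel `Y` to `P.X ⊙ₗ X` because `I ⊙ₗ X` is injective, and this extension comes
from a map out of `P.X ⊗ K`, for `K = [X, X]`. -/
lemma IsCInjective.mono_comoduleCounit [RigidCategory C] [EnoughInjectives C]
    (hX : IsCInjective C X) : Mono (comoduleCounit P) := by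
  let Y := kernel (comoduleRel P)
  have := hX _ (Injective.injective_under ((internalCohom C X).obj Y))
  let g := coev C X Y ≫ Injective.ι ((internalCohom C X).obj Y) ⊵ₗ X
  obtain ⟨s, hs⟩ := (tensorCoevCoend_bijective C X _ _).2
    (Injective.factorThru g (kernel.ι (comoduleRel P)))
  refine mono_of_mono_fac (f := P.coact ≫ s) (h := Injective.ι _) ?_
  apply internalCohom_ext
  refine Eq.trans ?_ (Injective.comp_factorThru g (kernel.ι (comoduleRel P)))
  rw [← hs, comp_actionHomLeft, reassoc_of% coev_cocurry]
  have := kernel.condition (comoduleRel P)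
  rw [Preadditive.comp_sub, sub_eq_zero] at this
  simp only [comp_actionHomLeft, reassoc_of% this]

lemma IsCInjective.epi_comoduleCounit [Abelian C] [MonoidalPreadditive C] [Linear k C]
    [Linear k M] [BilinearAction k C M] [RigidCategory C] [EnoughInjectives C]
    (hX : IsCInjective C X) : Epi (comoduleCounit P) := by
  refine Preadditive.epi_of_cancel_zero _ fun {W} t ht => ?_
  rw [← cancel_mono (Injective.ι W), zero_comp]
  obtain ⟨r, hr⟩ : ∃ r, r = t ≫ Injective.ι W := ⟨_, rfl⟩
  rw [← hr]
  have hq : kernel.ι (comoduleRel P) ≫ r ⊵ₗ X = 0 := by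
    have := congr(coev C X _ ≫ ($ht ≫ Injective.ι W) ⊵ₗ X)
    rwa [zero_comp, zero_actionHomLeft k, comp_zero, Category.assoc, ← hr,
      comp_actionHomLeft, reassoc_of% coev_cocurry] at this
  have := hX _ (Injective.injective_under W)
  have ex : (ShortComplex.mk _ _ (kernel.condition (comoduleRel P))).Exact :=
    ShortComplex.exact_kernel _
  obtain ⟨s, hs⟩ := (tensorCoevCoend_bijective C X _ _).2 (ex.descToInjective _ hq)
  have hu := ex.comp_descToInjective _ hq
  rw [← hs] at hu
  -- Both sides correspond to `r ⊵ₗ X`, which factors through `comoduleRel`. Precomposing with the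
  -- coaction then gives `r = 0` by coassociativity and counitality.
  have key : P.coact ▷ internalCoend C X ≫ s - P.X ◁ Δ[internalCoend C X] ≫ (α_ _ _ _).inv ≫ s =
      P.X ◁ ε[internalCoend C X] ≫ (ρ_ _).hom ≫ r := by
    apply (tensorCoevCoend_bijective C X _ _).1
    dsimp only
    rw [sub_actionHomLeft k, Preadditive.comp_sub, Preadditive.comp_sub]
    have hε : P.X ⊴ₗ coevCoend C X ≫ (αₗ P.X (internalCoend C X) X).inv ≫
        (P.X ◁ ε[internalCoend C X] ≫ (ρ_ _).hom ≫ r) ⊵ₗ X = r ⊵ₗ X := by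
      simp only [comp_actionHomLeft, Category.assoc, whiskerLeft_actionHomLeft,
        Iso.inv_hom_id_assoc, rightUnitor_actionHom]
      rw [← actionHomRight_comp_assoc, coev_counit, actionHomRight_inv_hom_assoc]
    rw [hε, ← hu]
    simp only [comp_actionHomLeft, Category.assoc, whiskerLeft_actionHomLeft,
      whiskerRight_actionHomLeft, Iso.inv_hom_id_assoc, Preadditive.sub_comp,
      associator_inv_actionHomLeft]
    rw [action_exchange_assoc, ← actionHomRight_comp_assoc _ _ (Δ[internalCoend C X] ⊵ₗ X),
      coev_comul]
    simp
  have := congr(P.coact ≫ $key)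
  simpa [reassoc_of% P.coact_comul, reassoc_of% P.coact_counit] using this.symm

end EssSurj

lemma IsCInjective.essSurj [Abelian C] [MonoidalPreadditive C] [Linear k C] [Linear k M]
    [BilinearAction k C M] [RigidCategory C] [EnoughInjectives C]
    (hX : IsCInjective C X) : (cohomComoduleFunctor C X).EssSurj where
  mem_essImage P := by
    have := hX.epi_comoduleCounit k P
    have := hX.mono_comoduleCounit P
    have := isIso_of_mono_of_epi (comoduleCounit P)
    let e : (internalCohom C X).obj (kernel (comoduleRel P)) ≅ P.X := asIso (comoduleCounit P)
    exact ⟨kernel (comoduleRel P), ⟨RComod.mkIso (P := cohomComodule C X (kernel (comoduleRel P)))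
      e (comoduleCounit_coact P)⟩⟩

theorem moduleEquivalent_of_isCInjectiveCCogenerator [Abelian C] [Linear k C]
    [MonoidalPreadditive C] [MonoidalLinear k C] [RigidCategory C] [Linear k M]
    [BilinearAction k C M] [EnoughInjectives C] [EnoughInjectives M]
    (hX : IsCInjectiveCCogenerator C X) : ModuleEquivalent k C (RComod (internalCoend C X)) M := by
  have := hX.faithful
  have := hX.full k
  have := hX.1.essSurj k
  have : (cohomComoduleFunctor C X).IsEquivalence := {}
  have := cohomComoduleFunctor_additive k (C := C) X
  have := cohomComoduleFunctor_linear k (C := C) X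
  exact ModuleEquivalent.of_isEquivalence k (cohomComoduleFunctor C X)

end Coclosed

end

end ModuleCategory

theorem theorem5p11
    (k : Type w) [Field k]
    (C : Type u₁) [Category.{v₁} C] [Abelian C] [Linear k C]
    [MonoidalCategory C] [MonoidalPreadditive C] [MonoidalLinear k C] [RigidCategory C]
    (M : Type u₂) [Category.{v₂} M] [Abelian M] [Linear k M]
    [MonoidalLeftAction C M] [ModuleCategory.BilinearAction k C M] (X : M) :
    (∀ [EnoughProjectives C] [EnoughProjectives M] [ModuleCategory.IsClosedObject C X],
      ModuleCategory.IsCProjectiveCGenerator C X →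
        ModuleCategory.ModuleEquivalent k C
          (ModuleCategory.RMod (ModuleCategory.internalEnd C X)) M) ∧
    (∀ [EnoughInjectives C] [EnoughInjectives M] [ModuleCategory.IsCoclosedObject C X],
      ModuleCategory.IsCInjectiveCCogenerator C X →
        ModuleCategory.ModuleEquivalent k C
          (ModuleCategory.RComod (ModuleCategory.internalCoend C X)) M) :=
  ⟨fun hX => ModuleCategory.moduleEquivalent_of_isCProjectiveCGenerator k hX,
    fun hX => ModuleCategory.moduleEquivalent_of_isCInjectiveCCogenerator k hX⟩
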